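/- Let $\lambda,c>0$ and $p,q\ge 0$ with $p+q\le 1$. A particle $(X(t),Y(t))$ starts at the origin of the plane at time $0$ and moves with constant speed $c$ along one of the four directions $d_j=(\cos(\pi j/2),\sin(\pi j/2))$, $j=0,1,2,3$ (indices modulo $4$). The initial direction is uniform on $\{d_0,d_1,d_2,d_3\}$. The direction changes at the events of a homogeneous Poisson process of rate $\lambda$ (whose interarrival times are i.i.d. exponential with rate $\lambda$): at each event, independently of everything else, the current direction $d_j$ is replaced by $d_{j+1}$ with probability $p$, by $d_{j-1}$ with probability $q$, and by $d_{j+2}$ with probability $1-p-q$. Then for all $t>0$ and $\alpha\in\mathbb{R}$ with $\lambda^2(1-p-q)^2\neq\alpha^2c^2$, $$\mathbb{E}\left[e^{i\alpha X(t)}\,\mathbf 1_{\{Y(t)=0\}}\right]=\frac{e^{-\lambda t}}{4}\left[\left(1+\frac{\lambda(1-p-q)}{s}\right)e^{ts}+\left(1-\frac{\lambda(1-p-q)}{s}\right)e^{-ts}\right],\qquad s=\sqrt{\lambda^2(1-p-q)^2-\alpha^2c^2},$$ where $s$ is either of the two complex square roots. If $\lambda^2(1-p-q)^2=\alpha^2c^2$,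 the formula holds with the right-hand side replaced by its limit as $s\to 0$: $$\mathbb{E}\left[e^{i\alpha X(t)}\,\mathbf 1_{\{Y(t)=0\}}\right]=\frac{e^{-\lambda t}}{2}\left[1+\lambda(1-p-q)\,t\right].$$ -/

import Mathlib

open MeasureTheory ProbabilityTheory

/-- The four orthogonal directions `d_j = (cos (π j / 2), sin (π j / 2))`, indexed modulo `4`. -/
noncomputable def orthDir (j : Fin 4) : ℝ × ℝ :=
  (Real.cos (Real.pi / 2 * (j : ℕ)), Real.sin (Real.pi / 2 * (j : ℕ)))

/-- The randomness that drives the planar motion with Poisson rate `lam`, probability `p` of a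
counter-clockwise turn, probability `q` of a clockwise turn and probability `1 - p - q` of a
reflection: the index `D₀` of the initial direction, the times `τ 0, τ 1, …` between consecutive
events of the Poisson process, and the turns `ξ 0, ξ 1, …` taken at these events, where a turn is
the increment modulo `4` of the index of the direction. -/
structure IsMotionDriver {Ω : Type*} [MeasurableSpace Ω] (P : Measure Ω) (lam p q : ℝ)
    (D₀ : Ω → Fin 4) (τ : ℕ → Ω → ℝ) (ξ : ℕ → Ω → Fin 4) : Prop where
  measurable_init : Measurable D₀
  measurable_wait : ∀ k, Measurable (τ k)
  measurable_turn : ∀ k, Measurable (ξ k)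
  /-- The initial direction is uniform. -/
  init_law : ∀ j, P.real {ω | D₀ ω = j} = 1 / 4
  /-- The interarrival times are exponential with rate `lam`. -/
  wait_law : ∀ k, P.map (τ k) = expMeasure lam
  turn_counterclockwise : ∀ k, P.real {ω | ξ k ω = 1} = p
  turn_clockwise : ∀ k, P.real {ω | ξ k ω = -1} = q
  turn_reflection : ∀ k, P.real {ω | ξ k ω = 2} = 1 - p - q
  /-- The initial direction, all interarrival times and all turns are mutually independent. -/
  indep_wait : iIndepFun τ P
  indep_turn : iIndepFun ξ P
  indep_wait_turn : IndepFun (fun ω k => τ k ω) (fun ω k => ξ k ω) P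
  indep_init : IndepFun D₀ (fun ω => ((fun k => τ k ω), (fun k => ξ k ω))) P

/-- The Poisson process `N(t)`: the number of arrival times `τ 0 + ⋯ + τ n`, `n = 0, 1, …`, that
are at most `t`. -/
noncomputable def numEvents {Ω : Type*} (τ : ℕ → Ω → ℝ) (t : ℝ) (ω : Ω) : ℕ :=
  {n : ℕ | ∑ i ∈ Finset.range (n + 1), τ i ω ≤ t}.ncard

/-- The index of the direction `D(t)` at time `t`. -/
noncomputable def dirIndex {Ω : Type*} (D₀ : Ω → Fin 4) (τ : ℕ → Ω → ℝ) (ξ : ℕ → Ω → Fin 4)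
    (t : ℝ) (ω : Ω) : Fin 4 :=
  D₀ ω + ∑ k ∈ Finset.range (numEvents τ t ω), ξ k ω

/-- The abscissa `X(t)` of the particle that starts at the origin and moves with speed `c`. -/
noncomputable def motionX {Ω : Type*} (c : ℝ) (D₀ : Ω → Fin 4) (τ : ℕ → Ω → ℝ)
    (ξ : ℕ → Ω → Fin 4) (t : ℝ) (ω : Ω) : ℝ :=
  ∫ s in (0 : ℝ)..t, c * (orthDir (dirIndex D₀ τ ξ s ω)).1

/-- The ordinate `Y(t)` of the particle that starts at the origin and moves with speed `c`. -/
noncomputable def motionY {Ω : Type*} (c : ℝ) (D₀ : Ω → Fin 4) (τ : ℕ → Ω → ℝ)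
    (ξ : ℕ → Ω → Fin 4) (t : ℝ) (ω : Ω) : ℝ :=
  ∫ s in (0 : ℝ)..t, c * (orthDir (dirIndex D₀ τ ξ s ω)).2

/-! Condition on the number `n` of turns made by time `t`. Unless all `n` turns are reflections and
the initial direction is horizontal, `Y(t) = 0` is a nontrivial linear relation between the waiting
times, which has probability `0` because their law has no atoms. If they are, `X` is a motion on the
line which reverses its direction at each event, and the contribution of these paths to the
expectation, for either initial direction `± 1`, is `(1 / 4) exp (-λ t) (λ (1 - p - q)) ^ n` times
the convolution of the `n + 1` exponentials `exp (± i α c t)`, `exp (∓ i α c t)`, … with alternating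
exponents. With `ρ = λ (1 - p - q)` and `z = i α c`, the sums of these contributions over `n` are
the Picard series of the telegraph system `f' = z f + ρ g`, `g' = -z g + ρ f`, `f 0 = g 0 = 1`,
whose explicit solution gives the formula. -/

section TelegraphSystem

/-- The convolution on the half-line of the `n + 1` exponentials `exp (z t)`, `exp (-z t)`,
`exp (z t)`, … with alternating exponents. -/
noncomputable def alternatingExpConv : ℕ → ℂ → ℝ → ℂ
  | 0, z, t => Complex.exp (z * t)
  | n + 1, z, t => ∫ x in (0 : ℝ)..t, Complex.exp (z * x) * alternatingExpConv n (-z) (t - x)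

@[fun_prop]
theorem continuous_alternatingExpConv (n : ℕ) (z : ℂ) : Continuous (alternatingExpConv n z) := by
  induction n generalizing z with
  | zero =>
    simp only [alternatingExpConv]
    fun_prop
  | succ n ih =>
    have := ih (-z)
    refine intervalIntegral.continuous_parametric_intervalIntegral_of_continuous
      (f := fun t x : ℝ => Complex.exp (z * x) * alternatingExpConv n (-z) (t - x)) ?_
      continuous_id
    fun_prop

/-- The telegraph system `f' = z f + ρ g`, `g' = -z g + ρ f` for the amplitudes of two modes with
opposite exponents which turn into each other at rate `ρ`, both started at `1`. -/
structure IsTelegraphSolution (ρ z : ℂ) (f g : ℝ → ℂ) : Prop where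
  hasDerivAt_fst : ∀ t, HasDerivAt f (z * f t + ρ * g t) t
  hasDerivAt_snd : ∀ t, HasDerivAt g (-z * g t + ρ * f t) t
  fst_zero : f 0 = 1
  snd_zero : g 0 = 1

theorem eq_exp_smul_add_integral_of_hasDerivAt {E : Type*} [NormedAddCommGroup E] [NormedSpace ℂ E]
    [CompleteSpace E] {z : ℂ} {f g : ℝ → E} (hf : ∀ t, HasDerivAt f (z • f t + g t) t)
    (hg : Continuous g) (t : ℝ) :
    f t = Complex.exp (z * t) • f 0 + ∫ x in (0 : ℝ)..t, Complex.exp (z * x) • g (t - x) := by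
  have hderiv (x : ℝ) : HasDerivAt (fun x : ℝ => Complex.exp (z * x) • f (t - x))
      (-(Complex.exp (z * x) • g (t - x))) x := by
    have hexp : HasDerivAt (fun x : ℝ => Complex.exp (z * x)) (Complex.exp (z * x) * (z * 1)) x :=
      (Complex.ofRealCLM.hasDerivAt.const_mul z).cexp
    refine (hexp.smul ((hf (t - x)).comp_const_sub t x)).congr_deriv ?_
    module
  have hftc := intervalIntegral.integral_eq_sub_of_hasDerivAt (fun x _ => hderiv x)
    (Continuous.intervalIntegrable (by fun_prop) 0 t)
  rw [intervalIntegral.integral_neg, neg_eq_iff_eq_neg] at hftc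
  simp [hftc]

namespace IsTelegraphSolution

variable {ρ z : ℂ} {f g : ℝ → ℂ}

theorem symm (h : IsTelegraphSolution ρ z f g) : IsTelegraphSolution ρ (-z) g f :=
  ⟨h.hasDerivAt_snd, by simpa only [neg_neg] using h.hasDerivAt_fst, h.snd_zero, h.fst_zero⟩

theorem continuous_fst (h : IsTelegraphSolution ρ z f g) : Continuous f :=
  continuous_iff_continuousAt.2 fun t => (h.hasDerivAt_fst t).continuousAt

theorem eq_exp_add_integral (h : IsTelegraphSolution ρ z f g) (t : ℝ) :
    f t = Complex.exp (z * t) + ∫ x in (0 : ℝ)..t, Complex.exp (z * x) * (ρ * g (t - x)) := by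
  simpa [h.fst_zero] using eq_exp_smul_add_integral_of_hasDerivAt (z := z) (f := f)
    (g := fun t => ρ * g t) h.hasDerivAt_fst (h.symm.continuous_fst.const_mul ρ) t

theorem sub_sum_range_succ (h : IsTelegraphSolution ρ z f g) (N : ℕ) (t : ℝ) :
    f t - ∑ n ∈ Finset.range (N + 1), ρ ^ n * alternatingExpConv n z t =
      ∫ x in (0 : ℝ)..t, Complex.exp (z * x) * (ρ * (g (t - x) -
        ∑ n ∈ Finset.range N, ρ ^ n * alternatingExpConv n (-z) (t - x))) := by
  have hg := h.symm.continuous_fst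
  have hterm (n : ℕ) : ρ ^ (n + 1) * alternatingExpConv (n + 1) z t =
      ∫ x in (0 : ℝ)..t, Complex.exp (z * x) *
        (ρ * (ρ ^ n * alternatingExpConv n (-z) (t - x))) := by
    rw [alternatingExpConv, ← intervalIntegral.integral_const_mul]
    congr with x
    ring
  simp only [mul_sub, Finset.mul_sum]
  rw [intervalIntegral.integral_sub (Continuous.intervalIntegrable (by fun_prop) _ _)
      (Continuous.intervalIntegrable (by fun_prop) _ _),
    intervalIntegral.integral_finsetSum
      (fun n _ => Continuous.intervalIntegrable (by fun_prop) _ _),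
    Finset.sum_range_succ', Finset.sum_congr rfl fun n _ => hterm n, h.eq_exp_add_integral t]
  simp only [alternatingExpConv, pow_zero, one_mul]
  ring

theorem norm_sub_sum_range_le (h : IsTelegraphSolution ρ z f g) {C T : ℝ}
    (hf : ∀ t ∈ Set.Icc 0 T, ‖f t‖ ≤ C) (hg : ∀ t ∈ Set.Icc 0 T, ‖g t‖ ≤ C) (N : ℕ) {t : ℝ}
    (ht : t ∈ Set.Icc 0 T) :
    ‖f t - ∑ n ∈ Finset.range N, ρ ^ n * alternatingExpConv n z t‖ ≤
      C * ((Real.exp (‖z‖ * T) * ‖ρ‖ * t) ^ N / N.factorial) := by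
  induction N generalizing z f g t with
  | zero => simpa using hf t ht
  | succ N ih =>
    set K := Real.exp (‖z‖ * T) * ‖ρ‖ with hK
    have hintegrand : ∀ x ∈ Set.Ioc 0 t, ‖Complex.exp (z * x) * (ρ * (g (t - x) -
        ∑ n ∈ Finset.range N, ρ ^ n * alternatingExpConv n (-z) (t - x)))‖ ≤
        C * K ^ (N + 1) / N.factorial * (t - x) ^ N := by
      intro x hx
      have hrem := ih h.symm hg hf (t := t - x) ⟨by linarith [hx.2], by linarith [hx.1, ht.2]⟩
      rw [norm_neg] at hrem
      have hexp : ‖Complex.exp (z * x)‖ ≤ Real.exp (‖z‖ * T) := by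
        refine (Complex.norm_exp_le_exp_norm _).trans (Real.exp_le_exp.2 ?_)
        rw [norm_mul, Complex.norm_of_nonneg hx.1.le]
        gcongr
        exact hx.2.trans ht.2
      calc _ ≤ Real.exp (‖z‖ * T) * (‖ρ‖ * (C * ((K * (t - x)) ^ N / N.factorial))) := by
            rw [norm_mul, norm_mul]
            gcongr
        _ = _ := by
            rw [mul_pow, pow_succ, hK]
            ring
    rw [h.sub_sum_range_succ]
    refine (intervalIntegral.norm_integral_le_of_norm_le ht.1
      (Filter.Eventually.of_forall hintegrand)
      (Continuous.intervalIntegrable (by fun_prop) _ _)).trans_eq ?_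
    rw [intervalIntegral.integral_const_mul,
      intervalIntegral.integral_comp_sub_left (fun x => x ^ N), integral_pow, Nat.factorial_succ]
    push_cast
    field_simp
    ring

theorem tendsto_sum_alternatingExpConv (h : IsTelegraphSolution ρ z f g) {t : ℝ} (ht : 0 ≤ t) :
    Filter.Tendsto (fun N => ∑ n ∈ Finset.range N, ρ ^ n * alternatingExpConv n z t)
      Filter.atTop (nhds (f t)) := by
  obtain ⟨C, hC⟩ := (isCompact_Icc (a := 0) (b := t)).exists_bound_of_continuousOn
    (h.continuous_fst.prodMk h.symm.continuous_fst).continuousOn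
  have hbound := h.norm_sub_sum_range_le (fun x hx => (norm_fst_le _).trans (hC x hx))
    (fun x hx => (norm_snd_le _).trans (hC x hx))
  rw [tendsto_iff_norm_sub_tendsto_zero]
  refine squeeze_zero (fun _ => norm_nonneg _)
    (fun N => (norm_sub_rev _ _).trans_le (hbound N ⟨ht, le_rfl⟩)) ?_
  simpa only [mul_zero] using (FloorSemiring.tendsto_pow_div_factorial_atTop _).const_mul C

end IsTelegraphSolution

theorem isTelegraphSolution_cosh_add_sinh {ρ z s : ℂ} (hs : s ^ 2 = ρ ^ 2 + z ^ 2) (hs0 : s ≠ 0) :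
    IsTelegraphSolution ρ z
      (fun t => Complex.cosh (s * t) + (ρ + z) / s * Complex.sinh (s * t))
      (fun t => Complex.cosh (s * t) + (ρ - z) / s * Complex.sinh (s * t)) := by
  have hderiv (a : ℂ) (t : ℝ) : HasDerivAt
      (fun t : ℝ => Complex.cosh (s * t) + a / s * Complex.sinh (s * t))
      (s * Complex.sinh (s * t) + a * Complex.cosh (s * t)) t := by
    have hmul (w : ℂ) : HasDerivAt (fun w => s * w) (s * 1) w := (hasDerivAt_id w).const_mul s
    refine (((hmul t).ccosh.add ((hmul t).csinh.const_mul (a / s))).comp_ofReal).congr_deriv ?_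
    field_simp
  refine ⟨fun t => (hderiv _ t).congr_deriv ?_, fun t => (hderiv _ t).congr_deriv ?_,
    by simp, by simp⟩
  all_goals
    field_simp
    linear_combination Complex.sinh (s * t) * hs

theorem isTelegraphSolution_affine {ρ z : ℂ} (h : ρ ^ 2 + z ^ 2 = 0) :
    IsTelegraphSolution ρ z (fun t => 1 + (ρ + z) * t) (fun t => 1 + (ρ - z) * t) := by
  have hderiv (a : ℂ) (t : ℝ) : HasDerivAt (fun t : ℝ => 1 + a * t) (a * 1) t :=
    (Complex.ofRealCLM.hasDerivAt.const_mul a).const_add 1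
  refine ⟨fun t => (hderiv _ t).congr_deriv ?_, fun t => (hderiv _ t).congr_deriv ?_,
    by simp, by simp⟩
  all_goals linear_combination -(t : ℂ) * h

end TelegraphSystem

section Genericity

variable {Ω β : Type*} [MeasurableSpace Ω] [MeasurableSpace β] {P : Measure Ω}

theorem ae_ne_of_indepFun [MeasurableEq β] [IsFiniteMeasure P] {X Y : Ω → β}
    (hX : Measurable X) (hY : Measurable Y) (hXY : IndepFun X Y P)
    [NullSingletonClass (P.map X)] : ∀ᵐ ω ∂P, X ω ≠ Y ω := by
  have hmap := (indepFun_iff_map_prod_eq_prod_map_map hX.aemeasurable hY.aemeasurable).1 hXY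
  have hdiag : P.map (fun ω => (X ω, Y ω)) (Set.diagonal β) = 0 := by
    rw [hmap, Measure.prod_apply_symm measurableSet_diagonal]
    have (y : β) : (fun x => (x, y)) ⁻¹' Set.diagonal β = {y} := by
      ext x
      simp
    simp [this]
  rw [Measure.map_apply (hX.prodMk hY) measurableSet_diagonal] at hdiag
  rw [ae_iff]
  simpa [Set.preimage, Set.diagonal] using hdiag

theorem ae_sum_mul_ne [IsFiniteMeasure P] {ι : Type*} {X : ι → Ω → ℝ}
    (hX : ∀ i, Measurable (X i)) (hind : iIndepFun X P) {s : Finset ι} (a : ι → ℝ) {k : ι}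
    [NullSingletonClass (P.map (X k))] (hk : k ∈ s) (hak : a k ≠ 0) (b : ℝ) :
    ∀ᵐ ω ∂P, ∑ i ∈ s, a i * X i ω ≠ b := by
  classical
  have hsum : Measurable fun x : s.erase k → ℝ => (b - ∑ i : s.erase k, a i * x i) / a k := by
    fun_prop
  have hindep := (hind.indepFun_finset {k} (s.erase k) (by simp) hX).comp
    (measurable_pi_apply (⟨k, Finset.mem_singleton_self k⟩ : ({k} : Finset ι))) hsum
  filter_upwards [ae_ne_of_indepFun (hX k) (by fun_prop) hindep] with ω hω hb
  refine hω ?_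
  rw [← Finset.add_sum_erase s _ hk] at hb
  rw [Function.comp_apply, Finset.sum_coe_sort (s.erase k) fun i => a i * X i ω, eq_div_iff hak]
  linarith

theorem ae_exists_notMem_of_iIndepFun {X : ℕ → Ω → β} (hX : ∀ k, Measurable (X k))
    (hind : iIndepFun X P) {μ : Measure β} (hμ : ∀ k, P.map (X k) = μ) {s : Set β}
    (hs : MeasurableSet s) (hlt : μ s < 1) : ∀ᵐ ω ∂P, ∃ k, X k ω ∉ s := by
  have hbound (n : ℕ) : P {ω | ¬ ∃ k, X k ω ∉ s} ≤ μ s ^ n := by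
    calc P {ω | ¬ ∃ k, X k ω ∉ s} ≤ P (⋂ k ∈ Finset.range n, X k ⁻¹' s) := by
          refine measure_mono fun ω hω => ?_
          simpa using fun k _ => not_not.1 (not_exists.1 hω k)
      _ = ∏ k ∈ Finset.range n, P (X k ⁻¹' s) :=
          hind.measure_inter_preimage_eq_mul _ fun _ _ => hs
      _ = μ s ^ n := by
          simp only [← Measure.map_apply (hX _) hs, hμ, Finset.prod_const, Finset.card_range]
  exact ae_iff.2 (le_antisymm
    (ge_of_tendsto' (ENNReal.tendsto_pow_atTop_nhds_zero_of_lt_one hlt) hbound) zero_le)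

theorem integral_indicator_one_comp {X : Ω → β} (hX : Measurable X) {s : Set β}
    (hs : MeasurableSet s) : ∫ ω, s.indicator (1 : β → ℂ) (X ω) ∂P = P.real (X ⁻¹' s) := by
  change ∫ ω, (X ⁻¹' s).indicator (fun _ => (1 : ℂ)) ω ∂P = _
  rw [integral_indicator_const _ (hX hs), Complex.real_smul, mul_one]

end Genericity

section Exponential

variable {lam : ℝ}

instance nullSingletonClass_expMeasure : NullSingletonClass (expMeasure lam) :=
  inferInstanceAs (NullSingletonClass (volume.withDensity (exponentialPDF lam)))

theorem expMeasure_real_Iic (hlam : 0 < lam) {t : ℝ} (ht : 0 ≤ t) :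
    (expMeasure lam).real (Set.Iic t) = 1 - Real.exp (-(lam * t)) := by
  have := isProbabilityMeasure_expMeasure hlam
  rw [← cdf_eq_real, cdf_expMeasure_eq hlam, if_pos ht]

theorem integral_indicator_Iic_expMeasure {E : Type*} [NormedAddCommGroup E] [NormedSpace ℝ E]
    (hlam : 0 ≤ lam) {t : ℝ} (ht : 0 ≤ t) (f : ℝ → E) :
    ∫ x, (Set.Iic t).indicator f x ∂expMeasure lam =
      ∫ x in (0 : ℝ)..t, (lam * Real.exp (-(lam * x))) • f x := by
  change ∫ x, _ ∂(volume.withDensity (exponentialPDF lam)) = _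
  rw [integral_withDensity_eq_integral_toReal_smul
      (f := exponentialPDF lam) (measurable_exponentialPDFReal lam).ennreal_ofReal
      (Filter.Eventually.of_forall fun x => ENNReal.ofReal_lt_top),
    intervalIntegral.integral_of_le ht, ← integral_Icc_eq_integral_Ioc,
    ← integral_indicator measurableSet_Icc]
  congr with x
  rw [exponentialPDF_eq]
  by_cases hx : 0 ≤ x
  · rw [if_pos hx, ENNReal.toReal_ofReal (by positivity)]
    by_cases hxt : x ≤ t <;> simp [hx, hxt]
  · simp [hx]

end Exponential

theorem measurableSet_pi_Iio_const_singleton {α : Type*} [MeasurableSpace α]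
    [MeasurableSingletonClass α] {n : ℕ} {a : α} :
    MeasurableSet ((Set.Iio n).pi fun _ => ({a} : Set α)) :=
  .pi (Set.to_countable _) fun _ _ => measurableSet_singleton a

theorem integral_pi_eq_integral_integral_cons {n : ℕ} {X : Fin (n + 1) → Type*}
    [∀ i, MeasurableSpace (X i)] {μ : ∀ i, Measure (X i)} [∀ i, SigmaFinite (μ i)]
    {E : Type*} [NormedAddCommGroup E] [NormedSpace ℝ E] {f : (∀ i, X i) → E}
    (hf : Integrable f (Measure.pi μ)) :
    ∫ u, f u ∂Measure.pi μ =
      ∫ x, ∫ v, f (Fin.cons x v) ∂Measure.pi (fun i : Fin n => μ i.succ) ∂μ 0 := by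
  have hmp := (measurePreserving_piFinSuccAbove μ 0).symm
  rw [← hmp.integral_comp', integral_prod (fun x => f (_ : ∀ i, X i))
    ((hmp.integrable_comp_emb (MeasurableEquiv.measurableEmbedding _)).2 hf)]
  simp only [MeasurableEquiv.piFinSuccAbove_symm_apply, Fin.insertNthEquiv_zero]
  rfl

section HoldingIntervals

/-- The time `u 0 + ⋯ + u (n - 1)` of the `n`-th event when the waiting times are `u 0, u 1, …`;
the time `0` counts as the event number `0`. -/
def arrivalTime (u : ℕ → ℝ) (n : ℕ) : ℝ :=
  ∑ i ∈ Finset.range n, u i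

/-- The times at which exactly `n` events have occurred when the waiting times `u` are positive. -/
def holdingInterval (u : ℕ → ℝ) (n : ℕ) : Set ℝ :=
  Set.Ico (arrivalTime u n) (arrivalTime u (n + 1))

/-- The integral over `[0, t]` of the step function with value `g k` on `holdingInterval u k`, where
`n` is the index of the holding interval which contains `t`. -/
def stepIntegral (g u : ℕ → ℝ) (n : ℕ) (t : ℝ) : ℝ :=
  ∑ k ∈ Finset.range n, g k * u k + g n * (t - arrivalTime u n)

variable {g u : ℕ → ℝ} {n : ℕ} {t : ℝ}

@[simp]
theorem arrivalTime_zero : arrivalTime u 0 = 0 :=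
  Finset.sum_range_zero u

theorem arrivalTime_succ : arrivalTime u (n + 1) = arrivalTime u n + u n :=
  Finset.sum_range_succ u n

theorem arrivalTime_succ' : arrivalTime u (n + 1) = arrivalTime (fun k => u (k + 1)) n + u 0 :=
  Finset.sum_range_succ' u n

theorem mem_holdingInterval_succ_iff :
    t ∈ holdingInterval u (n + 1) ↔ t - u 0 ∈ holdingInterval (fun k => u (k + 1)) n := by
  simp only [holdingInterval, arrivalTime_succ' (u := u), Set.mem_Ico, le_sub_iff_add_le,
    sub_lt_iff_lt_add]

theorem stepIntegral_succ' : stepIntegral g u (n + 1) t =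
    g 0 * u 0 + stepIntegral (fun k => g (k + 1)) (fun k => u (k + 1)) n (t - u 0) := by
  simp only [stepIntegral, Finset.sum_range_succ' (fun k => g k * u k), arrivalTime_succ' (u := u)]
  ring

theorem stepIntegral_const_mul (a : ℝ) :
    stepIntegral (fun k => a * g k) u n t = a * stepIntegral g u n t := by
  simp only [stepIntegral, mul_add, Finset.mul_sum, mul_assoc]

theorem stepIntegral_congr {g' : ℕ → ℝ} (h : ∀ k ≤ n, g k = g' k) :
    stepIntegral g u n t = stepIntegral g' u n t := by
  simp only [stepIntegral, h n le_rfl]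
  rw [Finset.sum_congr rfl fun k hk => by rw [h k (Finset.mem_range.1 hk).le]]

theorem stepIntegral_eq_sum_sub_mul_add : stepIntegral g u n t =
    ∑ k ∈ Finset.range n, (g k - g n) * u k + g n * t := by
  simp only [stepIntegral, arrivalTime, sub_mul, Finset.sum_sub_distrib, Finset.mul_sum, mul_sub]
  ring

theorem strictMono_arrivalTime (hu : ∀ k, 0 < u k) : StrictMono (arrivalTime u) :=
  strictMono_nat_of_lt_succ fun n => by
    rw [arrivalTime_succ]
    exact lt_add_of_pos_right _ (hu n)

theorem arrivalTime_nonneg (hu : ∀ k, 0 < u k) (n : ℕ) : 0 ≤ arrivalTime u n :=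
  Finset.sum_nonneg fun k _ => (hu k).le

theorem hasSum_indicator_holdingInterval {E : Type*} [AddCommMonoid E] [TopologicalSpace E]
    (hu : ∀ k, 0 < u k) (hunbdd : ¬ BddAbove (Set.range (arrivalTime u))) (ht : 0 ≤ t) (f : ℝ → E) :
    HasSum (fun n => (holdingInterval u n).indicator f t) (f t) := by
  have hmono := (strictMono_arrivalTime hu).monotone
  have hdisj : Pairwise (Function.onFun Disjoint (holdingInterval u)) :=
    hmono.pairwise_disjoint_on_Ico_succ
  obtain ⟨n, hn⟩ : ∃ n, t ∈ holdingInterval u n := by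
    have hcover := iUnion_Ico_map_succ_eq_Ici (f := arrivalTime u) (fun n => hmono bot_le) hunbdd
    have ht' : t ∈ Set.Ici (arrivalTime u ⊥) := by simpa using ht
    rw [← hcover] at ht'
    exact Set.mem_iUnion.1 ht'
  convert hasSum_single n fun m hm => Set.indicator_of_notMem
    (fun hmt => Set.disjoint_left.1 (hdisj hm) hmt hn) f
  exact (Set.indicator_of_mem hn f).symm

variable {Ω : Type*} {τ : ℕ → Ω → ℝ} {ω : Ω}

theorem numEvents_eq_of_mem_holdingInterval (hτ : ∀ k, 0 < τ k ω)
    (ht : t ∈ holdingInterval (fun k => τ k ω) n) : numEvents τ t ω = n := by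
  have hmono := strictMono_arrivalTime hτ
  have hevents : {m : ℕ | ∑ i ∈ Finset.range (m + 1), τ i ω ≤ t} = Set.Iio n := by
    ext m
    refine ⟨fun hm => ?_, fun hm => (hmono.monotone (Nat.succ_le_of_lt hm)).trans ht.1⟩
    exact Nat.lt_of_succ_lt_succ (hmono.lt_iff_lt.1 (lt_of_le_of_lt hm ht.2))
  rw [numEvents, hevents, ← Nat.card_coe_set_eq]
  simp

theorem intervalIntegrable_comp_numEvents (hτ : ∀ k, 0 < τ k ω) (g : ℕ → ℝ)
    (ht : t ∈ Set.Icc (arrivalTime (fun k => τ k ω) n) (arrivalTime (fun k => τ k ω) (n + 1))) :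
    IntervalIntegrable (fun s => g (numEvents τ s ω)) volume
      (arrivalTime (fun k => τ k ω) n) t := by
  refine (intervalIntegrable_const (c := g n)).congr_uIoo ?_
  rw [Set.uIoo_of_le ht.1]
  intro s hs
  simp only [numEvents_eq_of_mem_holdingInterval hτ ⟨hs.1.le, hs.2.trans_le ht.2⟩]

theorem integral_comp_numEvents_of_mem_Icc (hτ : ∀ k, 0 < τ k ω) (g : ℕ → ℝ)
    (ht : t ∈ Set.Icc (arrivalTime (fun k => τ k ω) n) (arrivalTime (fun k => τ k ω) (n + 1))) :
    ∫ s in arrivalTime (fun k => τ k ω) n..t, g (numEvents τ s ω) =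
      g n * (t - arrivalTime (fun k => τ k ω) n) := by
  rw [intervalIntegral.integral_congr_Ioo_of_le (g := fun _ => g n) ht.1 fun s hs => by
      simp only [numEvents_eq_of_mem_holdingInterval hτ ⟨hs.1.le, hs.2.trans_le ht.2⟩],
    intervalIntegral.integral_const, smul_eq_mul, mul_comm]

theorem integral_comp_numEvents (hτ : ∀ k, 0 < τ k ω) (g : ℕ → ℝ)
    (ht : t ∈ holdingInterval (fun k => τ k ω) n) :
    ∫ s in (0 : ℝ)..t, g (numEvents τ s ω) = stepIntegral g (fun k => τ k ω) n t := by
  set T := arrivalTime (fun k => τ k ω) with hT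
  have hmono := (strictMono_arrivalTime hτ).monotone
  have hmem (k : ℕ) : T (k + 1) ∈ Set.Icc (T k) (T (k + 1)) := ⟨hmono k.le_succ, le_rfl⟩
  have hint (k : ℕ) := intervalIntegrable_comp_numEvents hτ g (hmem k)
  have hsum : ∑ k ∈ Finset.range n, g k * τ k ω = ∫ s in (0 : ℝ)..T n, g (numEvents τ s ω) := by
    rw [← arrivalTime_zero (u := fun k => τ k ω),
      ← intervalIntegral.sum_integral_adjacent_intervals fun k _ => hint k]
    refine Finset.sum_congr rfl fun k _ => ?_
    rw [integral_comp_numEvents_of_mem_Icc hτ g (hmem k), hT, arrivalTime_succ, add_sub_cancel_left]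
  have htn := Set.Ico_subset_Icc_self ht
  have hinit := IntervalIntegrable.trans_iterate (n := n) fun k _ => hint k
  rw [arrivalTime_zero] at hinit
  rw [stepIntegral, hsum, ← integral_comp_numEvents_of_mem_Icc hτ g htn,
    intervalIntegral.integral_add_adjacent_intervals hinit
      (intervalIntegrable_comp_numEvents hτ g htn)]

end HoldingIntervals

section GenericStepIntegral

variable {Ω : Type*} [MeasurableSpace Ω] {P : Measure Ω} [IsFiniteMeasure P] {X : ℕ → Ω → ℝ}
  [∀ k, NullSingletonClass (P.map (X k))] {t : ℝ}

theorem ae_stepIntegral_eq_zero_imp (hX : ∀ k, Measurable (X k)) (hind : iIndepFun X P)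
    (ht : t ≠ 0) (g : ℕ → ℝ) (n : ℕ) :
    ∀ᵐ ω ∂P, stepIntegral g (fun k => X k ω) n t = 0 → ∀ k ≤ n, g k = 0 := by
  simp only [stepIntegral_eq_sum_sub_mul_add, add_eq_zero_iff_eq_neg]
  by_cases hconst : ∀ k ∈ Finset.range n, g k = g n
  · refine Filter.Eventually.of_forall fun ω hω => ?_
    rw [Finset.sum_eq_zero fun k hk => by rw [hconst k hk, sub_self, zero_mul], eq_comm,
      neg_eq_zero, mul_eq_zero, or_iff_left ht] at hω
    intro k hk
    rcases hk.lt_or_eq with hk | rfl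
    · exact (hconst k (Finset.mem_range.2 hk)).trans hω
    · exact hω
  · push Not at hconst
    obtain ⟨k, hk, hne⟩ := hconst
    filter_upwards [ae_sum_mul_ne hX hind (fun k => g k - g n) hk (sub_ne_zero.2 hne) _]
      with ω hω hzero
    exact absurd hzero hω

theorem ae_forall_stepIntegral_eq_zero_imp {ι : Type*} [Countable ι] (hX : ∀ k, Measurable (X k))
    (hind : iIndepFun X P) (ht : t ≠ 0) (h : ι → ℝ) :
    ∀ᵐ ω ∂P, ∀ (n : ℕ) (e : ℕ → ι), stepIntegral (fun k => h (e k)) (fun k => X k ω) n t = 0 →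
      ∀ k ≤ n, h (e k) = 0 := by
  have hfin : ∀ᵐ ω ∂P, ∀ (n : ℕ) (v : Fin (n + 1) → ι),
      stepIntegral (fun k => h (v (Fin.ofNat (n + 1) k))) (fun k => X k ω) n t = 0 →
        ∀ k ≤ n, h (v (Fin.ofNat (n + 1) k)) = 0 :=
    ae_all_iff.2 fun n => ae_all_iff.2 fun v => ae_stepIntegral_eq_zero_imp hX hind ht _ n
  filter_upwards [hfin] with ω hω n e hzero
  have heq (k : ℕ) (hk : k ≤ n) : h (e k) = h (e (Fin.ofNat (n + 1) k)) := by
    rw [Fin.val_ofNat, Nat.mod_eq_of_lt (Nat.lt_succ_of_le hk)]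
  intro k hk
  rw [heq k hk]
  exact hω n (fun i => e i) ((stepIntegral_congr heq).symm.trans hzero) k hk

end GenericStepIntegral

section ReversalPhase

/-- If exactly `n` events have occurred at time `t` for the waiting times `u`, this is
`exp (z x)`, where `x` is the position at time `t` of the motion of unit speed on the line which
reverses its direction at each event; otherwise it is `0`. -/
noncomputable def reversalPhase : (n : ℕ) → ℂ → ℝ → (Fin (n + 1) → ℝ) → ℂ
  | 0, z, t, u => (Set.Ioi t).indicator (fun _ => Complex.exp (z * t)) (u 0)
  | n + 1, z, t, u => (Set.Iic t).indicator
      (fun x => Complex.exp (z * x) * reversalPhase n (-z) (t - x) (Fin.tail u)) (u 0)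

theorem measurable_reversalPhase (n : ℕ) (z : ℂ) :
    Measurable fun x : ℝ × (Fin (n + 1) → ℝ) => reversalPhase n z x.1 x.2 := by
  induction n generalizing z with
  | zero =>
    simp only [reversalPhase, Set.indicator_apply, Set.mem_Ioi]
    exact Measurable.ite (measurableSet_lt (by fun_prop) (by fun_prop)) (by fun_prop) (by fun_prop)
  | succ n ih =>
    have htail : Measurable fun x : ℝ × (Fin (n + 2) → ℝ) => (x.1 - x.2 0, Fin.tail x.2) := by
      unfold Fin.tail
      fun_prop
    simp only [reversalPhase, Set.indicator_apply, Set.mem_Iic]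
    exact Measurable.ite (measurableSet_le (by fun_prop) (by fun_prop))
      (Measurable.mul (by fun_prop) ((ih (-z)).comp htail)) (by fun_prop)

theorem norm_exp_mul_ofReal {z : ℂ} (hz : z.re = 0) (x : ℝ) : ‖Complex.exp (z * x)‖ = 1 := by
  simp [Complex.norm_exp, hz]

theorem norm_reversalPhase_le {z : ℂ} (hz : z.re = 0) (n : ℕ) (t : ℝ) (u : Fin (n + 1) → ℝ) :
    ‖reversalPhase n z t u‖ ≤ 1 := by
  induction n generalizing z t with
  | zero => exact (norm_indicator_le_norm_self _ _).trans (norm_exp_mul_ofReal hz t).le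
  | succ n ih =>
    refine (norm_indicator_le_norm_self _ _).trans ?_
    rw [norm_mul, norm_exp_mul_ofReal hz, one_mul]
    exact ih (by simpa using hz) _ _

theorem integrable_reversalPhase {z : ℂ} (hz : z.re = 0) (n : ℕ) (t : ℝ)
    (μ : Measure (Fin (n + 1) → ℝ)) [IsFiniteMeasure μ] : Integrable (reversalPhase n z t) μ :=
  .of_bound ((measurable_reversalPhase n z).comp measurable_prodMk_left).aestronglyMeasurable 1
    (Filter.Eventually.of_forall (norm_reversalPhase_le hz n t))

theorem integral_reversalPhase {lam : ℝ} (hlam : 0 < lam) {z : ℂ} (hz : z.re = 0) (n : ℕ) {t : ℝ}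
    (ht : 0 ≤ t) :
    ∫ u, reversalPhase n z t u ∂Measure.pi (fun _ : Fin (n + 1) => expMeasure lam) =
      Complex.exp (-(lam * t)) * (lam ^ n * alternatingExpConv n z t) := by
  have := isProbabilityMeasure_expMeasure hlam
  induction n generalizing z t with
  | zero =>
    rw [integral_pi_eq_integral_integral_cons (integrable_reversalPhase hz 0 t _)]
    simp only [reversalPhase, Fin.cons_zero, integral_const, probReal_univ, one_smul]
    rw [integral_indicator_const _ measurableSet_Ioi, ← Set.compl_Iic,
      probReal_compl_eq_one_sub measurableSet_Iic, expMeasure_real_Iic hlam ht]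
    simp [alternatingExpConv]
  | succ n ih =>
    have htail (x : ℝ) : ∫ v, reversalPhase (n + 1) z t (Fin.cons x v)
        ∂Measure.pi (fun _ : Fin (n + 1) => expMeasure lam) =
        (Set.Iic t).indicator (fun x => Complex.exp (z * x) * (Complex.exp (-(lam * (t - x : ℝ))) *
          (lam ^ n * alternatingExpConv n (-z) (t - x)))) x := by
      simp only [reversalPhase, Fin.cons_zero, Fin.tail_cons]
      by_cases hx : x ≤ t
      · simp only [Set.indicator_of_mem (Set.mem_Iic.2 hx), integral_const_mul]
        rw [ih (by simpa using hz) (sub_nonneg.2 hx)]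
      · simp [hx]
    rw [integral_pi_eq_integral_integral_cons (integrable_reversalPhase hz (n + 1) t _)]
    simp only [htail]
    rw [integral_indicator_Iic_expMeasure hlam.le ht, alternatingExpConv,
      ← intervalIntegral.integral_const_mul, ← intervalIntegral.integral_const_mul]
    congr with x
    have hexp : Complex.exp (-(lam * t)) =
        Complex.exp (-(lam * x)) * Complex.exp (-(lam * (t - x : ℝ))) := by
      rw [← Complex.exp_add]
      push_cast
      ring_nf
    rw [hexp, Complex.real_smul]
    push_cast
    ring

theorem reversalPhase_eq_indicator {u : ℕ → ℝ} (hu : ∀ k, 0 < u k) (n : ℕ) (z : ℂ) {t : ℝ}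
    (ht : 0 ≤ t) :
    reversalPhase n z t (fun i => u i) = (holdingInterval u n).indicator
      (fun t => Complex.exp (z * stepIntegral (fun k => (-1) ^ k) u n t)) t := by
  induction n generalizing z t u with
  | zero =>
    simp [reversalPhase, Set.indicator_apply, holdingInterval, arrivalTime, stepIntegral, ht]
  | succ n ih =>
    by_cases h0 : u 0 ≤ t
    · have hsucc : reversalPhase (n + 1) z t (fun i => u i) = Complex.exp (z * u 0) *
          reversalPhase n (-z) (t - u 0) (fun i => u (i + 1)) :=
        Set.indicator_of_mem (s := Set.Iic t) h0 _
      rw [hsucc, ih (fun k => hu (k + 1)) (-z) (sub_nonneg.2 h0)]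
      by_cases hmem : t - u 0 ∈ holdingInterval (fun k => u (k + 1)) n
      · rw [Set.indicator_of_mem hmem, Set.indicator_of_mem (mem_holdingInterval_succ_iff.2 hmem),
          ← Complex.exp_add, stepIntegral_succ']
        simp only [pow_succ', stepIntegral_const_mul]
        push_cast
        ring_nf
      · rw [Set.indicator_of_notMem hmem,
          Set.indicator_of_notMem (mt mem_holdingInterval_succ_iff.1 hmem), mul_zero]
    · rw [Set.indicator_of_notMem fun hmem => h0 ?_]
      · exact Set.indicator_of_notMem (s := Set.Iic t) h0 _
      · have hsub := (arrivalTime_nonneg (fun k => hu (k + 1)) n).trans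
          (mem_holdingInterval_succ_iff.1 hmem).1
        exact sub_nonneg.1 hsub

end ReversalPhase

section Directions

theorem orthDir_zero : orthDir 0 = (1, 0) := by simp [orthDir]

theorem orthDir_one : orthDir 1 = (0, 1) := by simp [orthDir]

theorem orthDir_two : orthDir 2 = (-1, 0) := by
  have : Real.pi / 2 * 2 = Real.pi := by ring
  simp [orthDir, this]

theorem orthDir_three : orthDir 3 = (0, -1) := by
  have : Real.pi / 2 * 3 = Real.pi / 2 + Real.pi := by ring
  simp [orthDir, this, Real.cos_add_pi, Real.sin_add_pi]

theorem orthDir_add_two (j : Fin 4) : orthDir (j + 2) = -orthDir j := by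
  fin_cases j
  · simp [orthDir_zero, orthDir_two]
  · change orthDir 3 = -orthDir 1
    simp [orthDir_one, orthDir_three]
  · change orthDir 0 = -orthDir 2
    simp [orthDir_zero, orthDir_two]
  · change orthDir 1 = -orthDir 3
    simp [orthDir_one, orthDir_three]

theorem orthDir_snd_eq_zero_iff (j : Fin 4) : (orthDir j).2 = 0 ↔ j = 0 ∨ j = 2 := by
  fin_cases j <;> simp [orthDir_zero, orthDir_one, orthDir_two, orthDir_three]

/-- The index of the direction of a motion which starts in the direction `j`, after the first `n`
of the turns `x 0, x 1, …`. -/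
def dirAfter (j : Fin 4) (x : ℕ → Fin 4) (n : ℕ) : Fin 4 :=
  j + ∑ k ∈ Finset.range n, x k

variable {j : Fin 4} {x : ℕ → Fin 4} {n : ℕ}

theorem dirAfter_succ : dirAfter j x (n + 1) = dirAfter j x n + x n := by
  rw [dirAfter, Finset.sum_range_succ, ← add_assoc, dirAfter]

theorem orthDir_dirAfter_of_forall_eq_two (hx : ∀ k < n, x k = 2) :
    orthDir (dirAfter j x n) = (-1 : ℝ) ^ n • orthDir j := by
  induction n with
  | zero => simp [dirAfter]
  | succ n ih =>
    rw [dirAfter_succ, hx n n.lt_succ_self, orthDir_add_two,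
      ih fun k hk => hx k (hk.trans n.lt_succ_self), pow_succ, mul_neg_one, neg_smul]

theorem forall_orthDir_dirAfter_snd_eq_zero_iff (hx : ∀ k, x k ≠ 0) :
    (∀ k ≤ n, (orthDir (dirAfter j x k)).2 = 0) ↔ (j = 0 ∨ j = 2) ∧ ∀ k < n, x k = 2 := by
  constructor
  · intro h
    refine ⟨(orthDir_snd_eq_zero_iff j).1 (by simpa [dirAfter] using h 0 n.zero_le), ?_⟩
    have hturn : ∀ a b : Fin 4, (a = 0 ∨ a = 2) → (a + b = 0 ∨ a + b = 2) → b ≠ 0 → b = 2 := by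
      decide
    intro k hk
    refine hturn (dirAfter j x k) _ ((orthDir_snd_eq_zero_iff _).1 (h k hk.le)) ?_ (hx k)
    rw [← dirAfter_succ]
    exact (orthDir_snd_eq_zero_iff _).1 (h (k + 1) hk)
  · rintro ⟨hj, hx⟩ k hk
    rw [orthDir_dirAfter_of_forall_eq_two fun i hi => hx i (hi.trans_le hk), Prod.smul_snd,
      (orthDir_snd_eq_zero_iff j).2 hj, smul_zero]

theorem stepIntegral_orthDir_fst (hx : ∀ k < n, x k = 2) (u : ℕ → ℝ) (t : ℝ) :
    stepIntegral (fun k => (orthDir (dirAfter j x k)).1) u n t =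
      (orthDir j).1 * stepIntegral (fun k => (-1) ^ k) u n t := by
  rw [← stepIntegral_const_mul]
  refine stepIntegral_congr fun k hk => ?_
  rw [orthDir_dirAfter_of_forall_eq_two fun i hi => hx i (hi.trans_le hk), Prod.smul_fst,
    smul_eq_mul, mul_comm]

variable {Ω : Type*} {D₀ : Ω → Fin 4} {τ : ℕ → Ω → ℝ} {ξ : ℕ → Ω → Fin 4} {ω : Ω} {c t : ℝ}

theorem motionX_eq_mul_stepIntegral (hτ : ∀ k, 0 < τ k ω)
    (ht : t ∈ holdingInterval (fun k => τ k ω) n) :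
    motionX c D₀ τ ξ t ω = c * stepIntegral
      (fun k => (orthDir (dirAfter (D₀ ω) (fun k => ξ k ω) k)).1) (fun k => τ k ω) n t :=
  (integral_comp_numEvents hτ
    (fun m => c * (orthDir (dirAfter (D₀ ω) (fun k => ξ k ω) m)).1) ht).trans
      (stepIntegral_const_mul c)

theorem motionY_eq_mul_stepIntegral (hτ : ∀ k, 0 < τ k ω)
    (ht : t ∈ holdingInterval (fun k => τ k ω) n) :
    motionY c D₀ τ ξ t ω = c * stepIntegral
      (fun k => (orthDir (dirAfter (D₀ ω) (fun k => ξ k ω) k)).2) (fun k => τ k ω) n t :=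
  (integral_comp_numEvents hτ
    (fun m => c * (orthDir (dirAfter (D₀ ω) (fun k => ξ k ω) m)).2) ht).trans
      (stepIntegral_const_mul c)

end Directions

section ReflectionPhase

/-- The contribution to `exp (z a)` of the paths which start in the direction `j` and have made
exactly `n` turns by time `t`, all of them reflections, where `a` is the abscissa at time `t` at
unit speed. The arguments `d`, `u` and `x` are the initial direction, the waiting times and the
turns. -/
noncomputable def reflectionPhase (j : Fin 4) (n : ℕ) (z : ℂ) (t : ℝ) (d : Fin 4) (u : ℕ → ℝ)
    (x : ℕ → Fin 4) : ℂ :=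
  ({j} : Set (Fin 4)).indicator 1 d * (((Set.Iio n).pi fun _ => {2}).indicator 1 x *
    reversalPhase n (z * (orthDir j).1) t fun i => u i)

theorem reflectionPhase_eq_indicator {u : ℕ → ℝ} (hu : ∀ k, 0 < u k) (j : Fin 4) (n : ℕ) (z : ℂ)
    {t : ℝ} (ht : 0 ≤ t) (d : Fin 4) (x : ℕ → Fin 4) :
    reflectionPhase j n z t d u x = (holdingInterval u n).indicator (fun t =>
      if d = j ∧ ∀ k < n, x k = 2 then
        Complex.exp (z * stepIntegral (fun k => (orthDir (dirAfter d x k)).1) u n t) else 0) t := by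
  rw [reflectionPhase, reversalPhase_eq_indicator hu n _ ht]
  by_cases h : d = j ∧ ∀ k < n, x k = 2
  · obtain ⟨rfl, hx⟩ := h
    have hmem : x ∈ (Set.Iio n).pi fun _ => ({2} : Set (Fin 4)) := hx
    simp only [Set.indicator_of_mem (Set.mem_singleton d), Set.indicator_of_mem hmem,
      Pi.one_apply, one_mul, true_and, if_pos hx, stepIntegral_orthDir_fst hx, Complex.ofReal_mul,
      mul_assoc]
  · simp only [if_neg h, Set.indicator_zero]
    rw [not_and_or] at h
    rcases h with hd | hx
    · rw [Set.indicator_of_notMem (by simpa using hd), zero_mul]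
    · have hmem : x ∉ (Set.Iio n).pi fun _ => ({2} : Set (Fin 4)) := hx
      rw [Set.indicator_of_notMem hmem, zero_mul, mul_zero]

theorem norm_reflectionPhase_le {z : ℂ} (hz : z.re = 0) (j : Fin 4) (n : ℕ) (t : ℝ) (d : Fin 4)
    (u : ℕ → ℝ) (x : ℕ → Fin 4) : ‖reflectionPhase j n z t d u x‖ ≤ 1 := by
  have hone {β : Type} (s : Set β) (y : β) : ‖s.indicator (1 : β → ℂ) y‖ ≤ 1 :=
    (norm_indicator_le_norm_self _ _).trans (by simp)
  rw [reflectionPhase, norm_mul, norm_mul]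
  exact mul_le_one₀ (hone _ _) (by positivity) (mul_le_one₀ (hone _ _) (norm_nonneg _)
    (norm_reversalPhase_le (by simp [hz]) _ _ _))

theorem measurable_indicator_pi_mul_reversalPhase (n : ℕ) (z : ℂ) (t : ℝ) :
    Measurable fun y : (ℕ → ℝ) × (ℕ → Fin 4) =>
      ((Set.Iio n).pi fun _ => {2}).indicator (1 : (ℕ → Fin 4) → ℂ) y.2 *
        reversalPhase n z t fun i => y.1 i :=
  ((measurable_one.indicator measurableSet_pi_Iio_const_singleton).comp measurable_snd).mul
    ((measurable_reversalPhase n z).comp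
      (f := fun y : (ℕ → ℝ) × (ℕ → Fin 4) => (t, fun i : Fin (n + 1) => y.1 i)) (by fun_prop))

end ReflectionPhase

namespace IsMotionDriver

variable {Ω : Type*} [MeasurableSpace Ω] {P : Measure Ω} {lam p q : ℝ} {D₀ : Ω → Fin 4}
  {τ : ℕ → Ω → ℝ} {ξ : ℕ → Ω → Fin 4}

theorem ae_wait_pos (h : IsMotionDriver P lam p q D₀ τ ξ) (hlam : 0 < lam) :
    ∀ᵐ ω ∂P, ∀ k, 0 < τ k ω := by
  have := isProbabilityMeasure_expMeasure hlam
  have hIic : expMeasure lam (Set.Iic 0) = 0 := by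
    rw [← measureReal_eq_zero_iff, expMeasure_real_Iic hlam le_rfl]
    simp
  have hpos : ∀ᵐ x ∂expMeasure lam, 0 < x := by
    simpa [ae_iff, Set.Iic] using hIic
  refine ae_all_iff.2 fun k => ?_
  rw [← h.wait_law k] at hpos
  exact ae_of_ae_map (h.measurable_wait k).aemeasurable hpos

theorem ae_not_bddAbove_arrivalTime (h : IsMotionDriver P lam p q D₀ τ ξ) (hlam : 0 < lam) :
    ∀ᵐ ω ∂P, ¬ BddAbove (Set.range (arrivalTime fun k => τ k ω)) := by
  have := isProbabilityMeasure_expMeasure hlam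
  have hlt (T : ℕ) : expMeasure lam (Set.Iic (T : ℝ)) < 1 := by
    rw [← ENNReal.toReal_lt_toReal (measure_ne_top _ _) ENNReal.one_ne_top, ENNReal.toReal_one]
    refine (expMeasure_real_Iic hlam T.cast_nonneg).trans_lt ?_
    linarith [Real.exp_pos (-(lam * T))]
  have hwait : ∀ᵐ ω ∂P, ∀ T : ℕ, ∃ k, τ k ω ∉ Set.Iic (T : ℝ) := ae_all_iff.2 fun T =>
    ae_exists_notMem_of_iIndepFun h.measurable_wait h.indep_wait h.wait_law measurableSet_Iic
      (hlt T)
  filter_upwards [h.ae_wait_pos hlam, hwait] with ω hpos hω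
  rintro ⟨B, hB⟩
  obtain ⟨T, hT⟩ := exists_nat_ge B
  obtain ⟨k, hk⟩ := hω T
  have hle := hB (Set.mem_range_self (k + 1))
  rw [arrivalTime_succ] at hle
  have := arrivalTime_nonneg hpos k
  exact hk (Set.mem_Iic.2 (by linarith))

theorem ae_turn_ne_zero [IsProbabilityMeasure P] (h : IsMotionDriver P lam p q D₀ τ ξ) :
    ∀ᵐ ω ∂P, ∀ k, ξ k ω ≠ 0 := by
  refine ae_all_iff.2 fun k => ?_
  have hsum : ∑ j : Fin 4, P.real (ξ k ⁻¹' {j}) = 1 := by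
    simpa using sum_measureReal_preimage_singleton (μ := P) (f := ξ k) Finset.univ
      fun j _ => h.measurable_turn k (measurableSet_singleton j)
  have h1 : P.real (ξ k ⁻¹' {1}) = p := h.turn_counterclockwise k
  have h2 : P.real (ξ k ⁻¹' {2}) = 1 - p - q := h.turn_reflection k
  have h3 : P.real (ξ k ⁻¹' {3}) = q := h.turn_clockwise k
  rw [Fin.sum_univ_four, h1, h2, h3] at hsum
  have h0 : P.real (ξ k ⁻¹' {0}) = 0 := by linarith
  rw [measureReal_eq_zero_iff] at h0
  simpa [ae_iff, Set.preimage] using h0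

theorem ae_motionY_eq_zero_iff [IsProbabilityMeasure P] (h : IsMotionDriver P lam p q D₀ τ ξ)
    (hlam : 0 < lam) {c t : ℝ} (hc : c ≠ 0) (ht : t ≠ 0) :
    ∀ᵐ ω ∂P, ∀ n, t ∈ holdingInterval (fun k => τ k ω) n →
      (motionY c D₀ τ ξ t ω = 0 ↔ (D₀ ω = 0 ∨ D₀ ω = 2) ∧ ∀ k < n, ξ k ω = 2) := by
  have (k : ℕ) : NullSingletonClass (P.map (τ k)) := by
    rw [h.wait_law]
    infer_instance
  filter_upwards [h.ae_wait_pos hlam, h.ae_turn_ne_zero,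
    ae_forall_stepIntegral_eq_zero_imp h.measurable_wait h.indep_wait ht fun j => (orthDir j).2]
    with ω hpos hturn hgeneric n hn
  rw [motionY_eq_mul_stepIntegral hpos hn, mul_eq_zero, or_iff_right hc,
    ← forall_orthDir_dirAfter_snd_eq_zero_iff hturn]
  refine ⟨hgeneric n _, fun hzero => ?_⟩
  rw [stepIntegral_congr (g' := fun _ => 0) hzero]
  simp [stepIntegral]

theorem ae_reflectionPhase_add_eq_indicator [IsProbabilityMeasure P]
    (h : IsMotionDriver P lam p q D₀ τ ξ) (hlam : 0 < lam) {c t : ℝ} (hc : c ≠ 0) (ht : 0 < t)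
    (z : ℂ) :
    ∀ᵐ ω ∂P, ∀ n,
      reflectionPhase 0 n (z * c) t (D₀ ω) (fun k => τ k ω) (fun k => ξ k ω) +
          reflectionPhase 2 n (z * c) t (D₀ ω) (fun k => τ k ω) (fun k => ξ k ω) =
        (holdingInterval (fun k => τ k ω) n).indicator (fun t =>
          {ω | motionY c D₀ τ ξ t ω = 0}.indicator
            (fun ω => Complex.exp (z * motionX c D₀ τ ξ t ω)) ω) t := by
  filter_upwards [h.ae_wait_pos hlam, h.ae_motionY_eq_zero_iff hlam hc ht.ne'] with ω hpos hY n
  rw [reflectionPhase_eq_indicator hpos _ _ _ ht.le, reflectionPhase_eq_indicator hpos _ _ _ ht.le]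
  by_cases hn : t ∈ holdingInterval (fun k => τ k ω) n
  · have hmem : ω ∈ {ω | motionY c D₀ τ ξ t ω = 0} ↔
        (D₀ ω = 0 ∨ D₀ ω = 2) ∧ ∀ k < n, ξ k ω = 2 := hY n hn
    classical
    simp only [Set.indicator_of_mem hn, Set.indicator_apply, hmem,
      motionX_eq_mul_stepIntegral hpos hn, Complex.ofReal_mul, mul_assoc]
    by_cases h0 : D₀ ω = 0 <;> simp [h0]
  · simp only [Set.indicator_of_notMem hn, add_zero]

theorem integral_indicator_pi_turn (h : IsMotionDriver P lam p q D₀ τ ξ) (n : ℕ) :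
    ∫ ω, ((Set.Iio n).pi fun _ => {2}).indicator (1 : (ℕ → Fin 4) → ℂ) (fun k => ξ k ω) ∂P =
      (1 - p - q) ^ n := by
  have hpre : (fun ω k => ξ k ω) ⁻¹' (Set.Iio n).pi (fun _ => {2}) =
      ⋂ k ∈ Finset.range n, ξ k ⁻¹' {2} := by
    ext ω
    simp
  have hreal (k : ℕ) : (P (ξ k ⁻¹' {2})).toReal = 1 - p - q := h.turn_reflection k
  rw [integral_indicator_one_comp (measurable_pi_lambda _ h.measurable_turn)
      measurableSet_pi_Iio_const_singleton, hpre, measureReal_def,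
    h.indep_turn.measure_inter_preimage_eq_mul _ fun _ _ => measurableSet_singleton _,
    ENNReal.toReal_prod]
  simp only [hreal, Finset.prod_const, Finset.card_range]
  push_cast
  rfl

theorem integral_reversalPhase_wait [IsProbabilityMeasure P] (h : IsMotionDriver P lam p q D₀ τ ξ)
    (hlam : 0 < lam) {z : ℂ} (hz : z.re = 0) (n : ℕ) {t : ℝ} (ht : 0 ≤ t) :
    ∫ ω, reversalPhase n z t (fun i => τ i ω) ∂P =
      Complex.exp (-(lam * t)) * (lam ^ n * alternatingExpConv n z t) := by
  have hτ := h.measurable_wait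
  have hmap := (iIndepFun_iff_map_fun_eq_pi_map (μ := P) (f := fun i : Fin (n + 1) => τ i)
    fun i => (hτ i).aemeasurable).1 (h.indep_wait.precomp Fin.val_injective)
  simp only [h.wait_law] at hmap
  rw [← integral_reversalPhase hlam hz n ht, ← hmap, integral_map]
  · exact Measurable.aemeasurable (by fun_prop)
  · exact ((measurable_reversalPhase n z).comp measurable_prodMk_left).aestronglyMeasurable

theorem measurable_reflectionPhase (h : IsMotionDriver P lam p q D₀ τ ξ) (j : Fin 4) (n : ℕ)
    (z : ℂ) (t : ℝ) : Measurable fun ω =>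
      reflectionPhase j n z t (D₀ ω) (fun k => τ k ω) (fun k => ξ k ω) :=
  ((measurable_one.indicator (measurableSet_singleton j)).comp h.measurable_init).mul
    ((measurable_indicator_pi_mul_reversalPhase n _ t).comp
      ((measurable_pi_lambda _ h.measurable_wait).prodMk
        (measurable_pi_lambda _ h.measurable_turn)))

theorem integrable_reflectionPhase [IsFiniteMeasure P] (h : IsMotionDriver P lam p q D₀ τ ξ)
    (j : Fin 4) (n : ℕ) {z : ℂ} (hz : z.re = 0) (t : ℝ) : Integrable (fun ω =>
      reflectionPhase j n z t (D₀ ω) (fun k => τ k ω) (fun k => ξ k ω)) P :=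
  .of_bound (h.measurable_reflectionPhase j n z t).aestronglyMeasurable 1
    (Filter.Eventually.of_forall fun _ => norm_reflectionPhase_le hz _ _ _ _ _ _)

theorem integral_reflectionPhase [IsProbabilityMeasure P] (h : IsMotionDriver P lam p q D₀ τ ξ)
    (hlam : 0 < lam) (j : Fin 4) (n : ℕ) {z : ℂ} (hz : z.re = 0) {t : ℝ} (ht : 0 ≤ t) :
    ∫ ω, reflectionPhase j n z t (D₀ ω) (fun k => τ k ω) (fun k => ξ k ω) ∂P =
      Complex.exp (-(lam * t)) / 4 *
        ((lam * (1 - p - q)) ^ n * alternatingExpConv n (z * (orthDir j).1) t) := by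
  have hτ : Measurable fun ω k => τ k ω := measurable_pi_lambda _ h.measurable_wait
  have hξ : Measurable fun ω k => ξ k ω := measurable_pi_lambda _ h.measurable_turn
  have hinit : ∫ ω, ({j} : Set (Fin 4)).indicator (1 : Fin 4 → ℂ) (D₀ ω) ∂P = 1 / 4 := by
    rw [integral_indicator_one_comp h.measurable_init (measurableSet_singleton j)]
    exact (congrArg _ (h.init_law j)).trans (by simp)
  simp only [reflectionPhase]
  rw [h.indep_init.integral_fun_comp_mul_comp
      (g := fun y : (ℕ → ℝ) × (ℕ → Fin 4) =>
        ((Set.Iio n).pi fun _ => {2}).indicator (1 : (ℕ → Fin 4) → ℂ) y.2 *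
          reversalPhase n (z * (orthDir j).1) t fun i => y.1 i)
      h.measurable_init.aemeasurable (hτ.prodMk hξ).aemeasurable
      (measurable_one.indicator (measurableSet_singleton j)).aestronglyMeasurable
      (measurable_indicator_pi_mul_reversalPhase n _ t).aestronglyMeasurable, hinit]
  have hphase : Measurable fun u : ℕ → ℝ =>
      reversalPhase n (z * (orthDir j).1) t fun i => u i :=
    (measurable_reversalPhase n _).comp
      (f := fun u : ℕ → ℝ => (t, fun i : Fin (n + 1) => u i)) (by fun_prop)
  have hmem : Measurable (((Set.Iio n).pi fun _ => {2}).indicator (1 : (ℕ → Fin 4) → ℂ)) :=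
    measurable_one.indicator measurableSet_pi_Iio_const_singleton
  dsimp only
  rw [h.indep_wait_turn.symm.integral_fun_comp_mul_comp hξ.aemeasurable hτ.aemeasurable
      hmem.aestronglyMeasurable hphase.aestronglyMeasurable, h.integral_indicator_pi_turn,
    h.integral_reversalPhase_wait hlam (by simp [hz]) n ht, mul_pow]
  ring

theorem hasSum_integral_reflectionPhase_add [IsProbabilityMeasure P]
    (h : IsMotionDriver P lam p q D₀ τ ξ) (hlam : 0 < lam) {c t : ℝ} (hc : c ≠ 0) (ht : 0 < t)
    {z : ℂ} (hz : z.re = 0) :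
    HasSum (fun n => ∫ ω,
        (reflectionPhase 0 n (z * c) t (D₀ ω) (fun k => τ k ω) (fun k => ξ k ω) +
          reflectionPhase 2 n (z * c) t (D₀ ω) (fun k => τ k ω) (fun k => ξ k ω)) ∂P)
      (∫ ω, {ω | motionY c D₀ τ ξ t ω = 0}.indicator
        (fun ω => Complex.exp (z * motionX c D₀ τ ξ t ω)) ω ∂P) := by
  have hphase := h.ae_reflectionPhase_add_eq_indicator hlam hc ht z
  have hsum {E : Type} [AddCommMonoid E] [TopologicalSpace E] (f : Ω → ℝ → E) : ∀ᵐ ω ∂P,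
      HasSum (fun n => (holdingInterval (fun k => τ k ω) n).indicator (f ω) t) (f ω t) := by
    filter_upwards [h.ae_wait_pos hlam, h.ae_not_bddAbove_arrivalTime hlam] with ω hpos hunbdd
    exact hasSum_indicator_holdingInterval hpos hunbdd ht.le _
  have hone := hsum fun _ _ => (1 : ℝ)
  refine hasSum_integral_of_dominated_convergence
    (fun n ω => (holdingInterval (fun k => τ k ω) n).indicator (fun _ => 1) t)
    (fun n => ?_) (fun n => ?_) (hone.mono fun ω hω => hω.summable)
    ((integrable_const 1).congr (hone.mono fun ω hω => hω.tsum_eq.symm)) ?_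
  · exact ((h.measurable_reflectionPhase 0 n _ t).add
      (h.measurable_reflectionPhase 2 n _ t)).aestronglyMeasurable
  · filter_upwards [hphase] with ω hω
    rw [hω n, norm_indicator_eq_indicator_norm]
    refine Set.indicator_le_indicator ((norm_indicator_le_norm_self _ _).trans_eq ?_)
    exact norm_exp_mul_ofReal hz _
  · filter_upwards [hphase, hsum fun ω t => {ω | motionY c D₀ τ ξ t ω = 0}.indicator
      (fun ω => Complex.exp (z * motionX c D₀ τ ξ t ω)) ω] with ω hω hω'
    simpa only [hω] using hω'

theorem integral_eq_of_isTelegraphSolution [IsProbabilityMeasure P]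
    (h : IsMotionDriver P lam p q D₀ τ ξ) (hlam : 0 < lam) {c t : ℝ} (hc : c ≠ 0) (ht : 0 < t)
    {z : ℂ} (hz : z.re = 0) {f g : ℝ → ℂ}
    (hfg : IsTelegraphSolution (lam * (1 - p - q)) (z * c) f g) :
    ∫ ω, {ω | motionY c D₀ τ ξ t ω = 0}.indicator
        (fun ω => Complex.exp (z * motionX c D₀ τ ξ t ω)) ω ∂P =
      Complex.exp (-(lam * t)) / 4 * (f t + g t) := by
  have hzc : (z * c).re = 0 := by simp [hz]
  have hterm (n : ℕ) := (integral_add (h.integrable_reflectionPhase 0 n hzc t)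
    (h.integrable_reflectionPhase 2 n hzc t)).trans <| congrArg₂ (· + ·)
      (h.integral_reflectionPhase hlam 0 n hzc ht.le)
      (h.integral_reflectionPhase hlam 2 n hzc ht.le)
  have hsum := (h.hasSum_integral_reflectionPhase_add hlam hc ht hz).tendsto_sum_nat
  refine tendsto_nhds_unique hsum ((((hfg.tendsto_sum_alternatingExpConv ht.le).add
    (hfg.symm.tendsto_sum_alternatingExpConv ht.le)).const_mul _).congr fun N => ?_)
  simp only [hterm, orthDir_zero, orthDir_two, Complex.ofReal_one, Complex.ofReal_neg, mul_one,
    mul_neg, ← Finset.mul_sum, ← mul_add, ← Finset.sum_add_distrib]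

end IsMotionDriver

theorem mainTheorem7 {Ω : Type*} [MeasurableSpace Ω] (P : Measure Ω) [IsProbabilityMeasure P]
    (lam c p q : ℝ) (hlam : 0 < lam) (hc : 0 < c) (hp : 0 ≤ p) (hq : 0 ≤ q) (hpq : p + q ≤ 1)
    (D₀ : Ω → Fin 4) (τ : ℕ → Ω → ℝ) (ξ : ℕ → Ω → Fin 4)
    (hdrive : IsMotionDriver P lam p q D₀ τ ξ)
    (t : ℝ) (ht : 0 < t) (α : ℝ) :
    (∀ s : ℂ, s ^ 2 = ((lam ^ 2 * (1 - p - q) ^ 2 - α ^ 2 * c ^ 2 : ℝ) : ℂ) → s ≠ 0 →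
      ∫ ω, {ω | motionY c D₀ τ ξ t ω = 0}.indicator
          (fun ω => Complex.exp (Complex.I * α * motionX c D₀ τ ξ t ω)) ω ∂P
        = Complex.exp (-(lam * t)) / 4 *
          ((1 + lam * (1 - p - q) / s) * Complex.exp (t * s)
            + (1 - lam * (1 - p - q) / s) * Complex.exp (-(t * s)))) ∧
    (lam ^ 2 * (1 - p - q) ^ 2 - α ^ 2 * c ^ 2 = 0 →
      ∫ ω, {ω | motionY c D₀ τ ξ t ω = 0}.indicator
          (fun ω => Complex.exp (Complex.I * α * motionX c D₀ τ ξ t ω)) ω ∂P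
        = Complex.exp (-(lam * t)) / 2 * (1 + lam * (1 - p - q) * t)) := by
  have hz : (Complex.I * α : ℂ).re = 0 := by simp
  have hsq : (lam * (1 - p - q) : ℂ) ^ 2 + (Complex.I * α * c) ^ 2 =
      ((lam ^ 2 * (1 - p - q) ^ 2 - α ^ 2 * c ^ 2 : ℝ) : ℂ) := by
    push_cast
    linear_combination (α : ℂ) ^ 2 * c ^ 2 * Complex.I_sq
  constructor
  · intro s hs hs0
    rw [hdrive.integral_eq_of_isTelegraphSolution hlam hc.ne' ht hz
      (isTelegraphSolution_cosh_add_sinh (hs.trans hsq.symm) hs0), Complex.cosh, Complex.sinh,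
      mul_comm s]
    ring
  · intro h0
    rw [hdrive.integral_eq_of_isTelegraphSolution hlam hc.ne' ht hz
      (isTelegraphSolution_affine (by rw [hsq, h0, Complex.ofReal_zero]))]
    ring
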